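/- All graphs are finite and simple. An acyclic moral orientation (AMO) of an undirected graph $H$ is an orientation of all edges of $H$ that has no directed cycle and no induced subgraph $a\to b\leftarrow c$ (that is, no such edges with $a\ne c$ non-adjacent in $H$); let $\#\mathrm{AMO}(H)$ be the number of AMOs of $H$. A topological ordering representing an orientation $\alpha$ is a linear ordering of all vertices in which $u$ precedes $v$ for every edge $u\to v$ of $\alpha$. Let $G=(V,E)$ be a connected chordal graph (no induced cycle on four or more vertices), and let $\Pi(G)$ be the set of its inclusion-maximal cliques. For a clique $K$ and a permutation $\pi$ of $K$, let $G^{\pi(K)}$ be the union of all AMOs of $G$ that are represented by some topological ordering beginning with $\pi$, and let $G^K=\bigcup_\pi G^{\pi(K)}$, where $\pi$ ranges over all permutations of $K$; an edge that occurs in both directions in such a union is called undirected. Let $\mathcal C_G(K)$ be the set of undirected connected components of $G^K[V\setminus K]$, i.e. the connected components of the undirected graph on $V\setminus K$ formed by the undirected edges of $G^K$ between vertices of $V\setminus K$. For a finite set $S$ and a collection $R$ of subsets of $S$, let $\phi(S,R)$ be the number of permutations of $S$ that have no initial segment whose set of elements belongs to $R$. A rooted clique tree of $G$ is a triple $\mathcal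 T=(T,r,\iota)$ in which $T=(V_T,E_T)$ is a tree with root $r$ and $\iota\colon V_T\to\Pi(G)$ is a bijection such that for every $u\in V$ the set $\{x\in V_T\mid u\in\iota(x)\}$ is connected in $T$. For a node $v$, let $r=x_1,x_2,\dots,x_p=v$ be the unique path in $T$ from $r$ to $v$, and let $$\mathrm{FP}(v,\mathcal T)=\{\,\iota(x_i)\cap\iota(x_{i+1})\mid 1\le i<p,\ \iota(x_i)\cap\iota(x_{i+1})\subseteq\iota(v)\,\}.$$ Proposition. For every connected chordal graph $G$ and every rooted clique tree $\mathcal T=(T,r,\iota)$ of $G$, $$\#\mathrm{AMO}(G)=\sum_{v\in V_T}\phi\bigl(\iota(v),\mathrm{FP}(v,\mathcal T)\bigr)\cdot\prod_{H\in\mathcal C_G(\iota(v))}\#\mathrm{AMO}(H).$$ -/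

import Mathlib

namespace CliquePicking

/-- A graph is chordal if it has no induced cycle on four or more vertices. -/
def IsChordal {V : Type*} (G : SimpleGraph V) : Prop :=
  ∀ n : ℕ, 4 ≤ n → IsEmpty (SimpleGraph.cycleGraph n ↪g G)

/-- Undirected connected chordal graphs. -/
structure IsUCCG {V : Type*} (G : SimpleGraph V) : Prop where
  connected : G.Connected
  chordal : IsChordal G

/-- `D` is an acyclic moral orientation of the undirected graph `G`. -/
structure IsAMO {V : Type*} (G : SimpleGraph V) (D : Digraph V) : Prop where
  /-- the skeleton of `D` is `G` -/
  skeleton : ∀ u v, G.Adj u v ↔ D.Adj u v ∨ D.Adj v u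
  /-- every edge has received only one direction -/
  oriented : ∀ u v, D.Adj u v → ¬ D.Adj v u
  /-- there is no directed cycle -/
  acyclic : ∀ v, ¬ Relation.TransGen D.Adj v v
  /-- there is no induced `a → b ← c` -/
  moral : ∀ a b c, a ≠ c → D.Adj a b → D.Adj c b → G.Adj a c

/-- The number of acyclic moral orientations of `G`. -/
noncomputable def numAMO {V : Type*} (G : SimpleGraph V) : ℕ :=
  {D : Digraph V | IsAMO G D}.ncard

section

variable {V : Type*} [DecidableEq V]

/-- `τ` lists every vertex exactly once, and every edge of `D` points from an earlier vertex of `τ`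
to a later one. -/
structure IsTopologicalOrdering (D : Digraph V) (τ : List V) : Prop where
  nodup : τ.Nodup
  complete : ∀ v, v ∈ τ
  precedes : ∀ u v, D.Adj u v → τ.idxOf u < τ.idxOf v

/-- The permutations of a finite set `S`, as duplicate-free lists with underlying set `S`. -/
def permsOf (S : Finset V) : Set (List V) :=
  {π | π.Nodup ∧ π.toFinset = S}

/-- `φ(S, R)`: the number of permutations of `S` no initial segment of which has a member of `R` as
its underlying set. -/
noncomputable def phi (S : Finset V) (R : Set (Finset V)) : ℕ :=
  {π ∈ permsOf S | ∀ p : List V, p <+: π → p.toFinset ∉ R}.ncard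

/-- The union `G^π` of all AMOs of `G` that are represented by some topological ordering beginning
with the sequence `π`. -/
def permOrientation (G : SimpleGraph V) (π : List V) : Digraph V :=
  sSup {D | IsAMO G D ∧ ∃ τ, IsTopologicalOrdering D τ ∧ π <+: τ}

/-- The union `G^K` of the graphs `G^π` over all permutations `π` of `K`. -/
def cliqueOrientation (G : SimpleGraph V) (K : Finset V) : Digraph V :=
  ⨆ π ∈ permsOf K, permOrientation G π

/-- The undirected edges of `G^K[V ∖ K]`. -/
def undirectedPart (G : SimpleGraph V) (K : Finset V) : SimpleGraph {v : V // v ∉ K} :=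
  (cliqueOrientation G K).toSimpleGraphStrict.comap Subtype.val

/-- `C_G(K)`: the undirected connected components of `G^K[V ∖ K]`. The graph belonging to a
component `H` is `H.toSimpleGraph`. -/
abbrev Components (G : SimpleGraph V) (K : Finset V) : Type _ :=
  (undirectedPart G K).ConnectedComponent

noncomputable instance instFintypeComponents [Fintype V] (G : SimpleGraph V) (K : Finset V) :
    Fintype (Components G K) :=
  Fintype.ofFinite _

end

/-- The set `Π(G)` of (inclusion-)maximal cliques. -/
def maximalCliques {V : Type*} (G : SimpleGraph V) : Set (Finset V) :=
  {K | Maximal (fun K' : Finset V => G.IsClique (K' : Set V)) K}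

/-- A rooted clique tree `(T, r, ι)` of `G` with node set `W`. -/
structure RootedCliqueTree {V : Type*} (G : SimpleGraph V) (W : Type*) where
  T : SimpleGraph W
  r : W
  ι : W → Finset V
  isTree : T.IsTree
  /-- `ι` is a bijection from the nodes onto the maximal cliques of `G` -/
  bijOn : Set.BijOn ι Set.univ (maximalCliques G)
  /-- the nodes whose clique contains a given vertex form a connected subgraph of `T` -/
  connected : ∀ v : V, (T.induce {x | v ∈ ι x}).Connected

/-- The forbidden prefixes of a node `v`: the sets `ι x ∩ ι y ⊆ ι v` for the successive nodes
`x, y` on the path from the root to `v`. -/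
def RootedCliqueTree.FP {V W : Type*} [DecidableEq V] {G : SimpleGraph V}
    (𝒯 : RootedCliqueTree G W) (v : W) : Set (Finset V) :=
  {S | ∃ p : 𝒯.T.Walk 𝒯.r v, p.IsPath ∧
    ∃ d ∈ p.darts, S = 𝒯.ι d.fst ∩ 𝒯.ι d.snd ∧ S ⊆ 𝒯.ι v}

end CliquePicking

namespace CliquePicking

/-! Every AMO `D` determines a triple: a node `x`, a permutation of its bag and an AMO of the free
edges outside the bag. The theorem counts these triples.

The order in which `D` lists an ancestral clique has the ancestral subsets of the clique as its
initial segments, so "no initial segment in `FP`" means "no ancestral forbidden prefix".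
`existsUnique_node` shows that exactly one ancestral bag has this property. For existence, cut the
tree at all ancestral separators: the component of the root contains an ancestral bag. For
uniqueness, two distinct ancestral bags have an ancestral intersection, which occurs as a separator
on the path between them; going from one to the other via the root, this separator cannot be
avoided.

Once the bag `K` is fixed as an ancestral set, certain edges are `Forced` by ancestrality, morality
and acyclicity, and no others are. Indeed any AMO of the remaining free graph, together with any
order of `K` and the forced edges, is an AMO of `G` (`isAMO_glue`). Hence the free graph is the
undirected part of `G^K`, and its AMOs factor over connected components. The decisive property is
`Forced.of_free`: a forced edge into one end of a free edge comes with one into the other end. -/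

/-- A set of vertices is ancestral if it contains all parents of its members. -/
def Ancestral {V : Type*} (D : Digraph V) (S : Set V) : Prop :=
  ∀ u v, D.Adj u v → v ∈ S → u ∈ S

theorem IsAMO.adj {V : Type*} {G : SimpleGraph V} {D : Digraph V} (hD : IsAMO G D) {u v : V}
    (h : D.Adj u v) : G.Adj u v :=
  (hD.skeleton u v).2 (Or.inl h)

theorem IsAMO.irrefl {V : Type*} {G : SimpleGraph V} {D : Digraph V} (hD : IsAMO G D) (u : V) :
    ¬ D.Adj u u :=
  fun h => hD.oriented u u h h

theorem Ancestral.inter {V : Type*} {D : Digraph V} {S T : Set V} (hS : Ancestral D S)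
    (hT : Ancestral D T) : Ancestral D (S ∩ T) :=
  fun u v h hv => ⟨hS u v h hv.1, hT u v h hv.2⟩

/-! ### Topological orderings and ancestral cliques -/

section Lists

variable {V : Type*} [DecidableEq V] {G : SimpleGraph V} {D : Digraph V}

/-- Every finite set of vertices of an acyclic digraph can be listed topologically. -/
theorem exists_topological_list (hac : ∀ v, ¬ Relation.TransGen D.Adj v v) (S : Finset V) :
    ∃ l ∈ permsOf S, l.Pairwise fun u v => ¬ D.Adj v u := by
  classical
  have hpo : IsPartialOrder V (Relation.ReflTransGen D.Adj) :=
    { refl := fun _ => Relation.ReflTransGen.refl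
      trans := fun _ _ _ => Relation.ReflTransGen.trans
      antisymm := fun a b hab hba => by
        by_contra hne
        rcases Relation.reflTransGen_iff_eq_or_transGen.1 hab with h | h
        · exact hne h.symm
        · exact hac a (h.trans_left hba) }
  obtain ⟨s, hs, hle⟩ := extend_partialOrder (Relation.ReflTransGen D.Adj)
  refine ⟨S.sort s, ⟨S.sort_nodup s, S.sort_toFinset s⟩, ?_⟩
  refine ((S.pairwise_sort s).and (S.sort_nodup s)).imp ?_
  rintro u v ⟨huv, hne⟩ h
  exact hne (antisymm huv (hle _ _ (Relation.ReflTransGen.single h)))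

theorem idxOf_lt_idxOf_of_pairwise {R : V → V → Prop} {l : List V}
    (hl : l.Pairwise fun u v => ¬ R v u) {u v : V} (hu : u ∈ l) (hv : v ∈ l) (huv : R u v)
    (hne : u ≠ v) : l.idxOf u < l.idxOf v := by
  by_contra hlt
  have h1 := List.idxOf_lt_length_of_mem hu
  have h2 := List.idxOf_lt_length_of_mem hv
  have hne' : l.idxOf v ≠ l.idxOf u := fun h => hne ((List.idxOf_inj hu).1 h.symm)
  have := List.pairwise_iff_getElem.1 hl _ _ h2 h1 (by omega)
  simp only [List.getElem_idxOf] at this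
  exact this huv

/-- Since `K` is a clique, its order fixes the orientation of every edge inside it. Conversely, an
ancestral `K` can be listed first, followed by a topological listing of the other vertices. -/
theorem isTopologicalOrdering_prefix_iff (hD : IsAMO G D) [Fintype V] {K : Finset V}
    (hK : G.IsClique (K : Set V)) {π : List V} (hπ : π ∈ permsOf K) :
    (∃ τ, IsTopologicalOrdering D τ ∧ π <+: τ) ↔
      Ancestral D (K : Set V) ∧ π.Pairwise D.Adj := by
  obtain ⟨hnd, rfl⟩ := hπ
  constructor
  · rintro ⟨τ, hτ, t, rfl⟩
    refine ⟨fun u v huv hv => ?_, ?_⟩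
    · have := hτ.precedes u v huv
      simp only [List.coe_toFinset, Set.mem_ofPred_eq] at hv ⊢
      rw [List.idxOf_append_of_mem hv] at this
      by_contra hu
      rw [List.idxOf_append_of_notMem hu] at this
      have := List.idxOf_lt_length_of_mem hv
      omega
    · rw [List.pairwise_iff_getElem]
      intro i j hi hj hij
      have hne : π[i] ≠ π[j] := fun h => hij.ne ((hnd.getElem_inj_iff).1 h)
      have hadj : G.Adj π[i] π[j] := hK (by simp) (by simp) hne
      refine ((hD.skeleton _ _).1 hadj).resolve_right fun h => ?_
      have := hτ.precedes _ _ h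
      rw [List.idxOf_append_of_mem (List.getElem_mem _),
        List.idxOf_append_of_mem (List.getElem_mem _), hnd.idxOf_getElem, hnd.idxOf_getElem] at this
      omega
  · rintro ⟨hanc, hpw⟩
    obtain ⟨l, ⟨hl, hlS⟩, hlpw⟩ := exists_topological_list hD.acyclic (Finset.univ \ π.toFinset)
    have hmem : ∀ v, v ∈ l ↔ v ∉ π := fun v => by
      rw [← List.mem_toFinset, hlS]; simp
    have hcomp : ∀ v, v ∈ π ++ l := fun v => by simp [hmem, em]
    refine ⟨π ++ l, ⟨?_, hcomp, ?_⟩, List.prefix_append _ _⟩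
    · rw [List.nodup_append]
      refine ⟨hnd, hl, ?_⟩
      rintro a ha b hb rfl
      exact (hmem a).1 hb ha
    · intro u v huv
      refine idxOf_lt_idxOf_of_pairwise (R := D.Adj) ?_ (hcomp u) (hcomp v) huv
        (fun h => hD.irrefl u (h ▸ huv))
      rw [List.pairwise_append]
      refine ⟨hpw.imp fun h => hD.oriented _ _ h, hlpw, fun a ha b hb hba => ?_⟩
      exact (hmem b).1 hb (by simpa using hanc b a hba (by simpa using ha))

/-- The elements of a clique can be listed along an acyclic moral orientation. -/
theorem exists_perm_of_isClique (hD : IsAMO G D) {K : Finset V} (hK : G.IsClique (K : Set V)) :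
    ∃ π ∈ permsOf K, π.Pairwise D.Adj := by
  obtain ⟨l, hl, hpw⟩ := exists_topological_list hD.acyclic K
  refine ⟨l, hl, ((hpw.and hl.1).imp_of_mem ?_)⟩
  rintro a b ha hb ⟨hab, hne⟩
  refine ((hD.skeleton _ _).1 (hK ?_ ?_ hne)).resolve_right hab <;>
  · rw [← hl.2]; simpa

theorem perm_unique (hD : IsAMO G D) {K : Finset V} {π π' : List V} (hπ : π ∈ permsOf K)
    (hπ' : π' ∈ permsOf K) (h : π.Pairwise D.Adj) (h' : π'.Pairwise D.Adj) : π = π' := by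
  refine List.Perm.eq_of_pairwise (fun a b _ _ hab hba => (hD.oriented a b hab hba).elim) h h' ?_
  rw [List.perm_ext_iff_of_nodup hπ.1 hπ'.1]
  intro a
  rw [← List.mem_toFinset, ← List.mem_toFinset, hπ.2, hπ'.2]

theorem exists_prefix_of_downward {R : V → V → Prop} {l : List V} (hl : l.Pairwise R)
    (hnd : l.Nodup) {S : Finset V} (hS : S ⊆ l.toFinset)
    (hdown : ∀ u ∈ l, ∀ v ∈ S, R u v → u ∈ S) :
    ∃ p, p <+: l ∧ p.toFinset = S := by
  induction l generalizing S with
  | nil => exact ⟨[], List.prefix_rfl, by simpa [eq_comm] using hS⟩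
  | cons x l ih =>
    rw [List.pairwise_cons] at hl
    rw [List.nodup_cons] at hnd
    by_cases hx : x ∈ S
    · obtain ⟨p, hp, hpS⟩ := ih (S := S.erase x) hl.2 hnd.2
        (fun y hy => by
          have h1 := Finset.mem_erase.1 hy
          have h2 := hS h1.2
          simp only [List.toFinset_cons, Finset.mem_insert] at h2
          exact h2.resolve_left h1.1)
        (fun u hu v hv huv => Finset.mem_erase.2
          ⟨fun h => hnd.1 (h ▸ hu), hdown u (by simp [hu]) v (Finset.mem_of_mem_erase hv) huv⟩)
      exact ⟨x :: p, List.cons_prefix_cons.2 ⟨rfl, hp⟩, by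
        rw [List.toFinset_cons, hpS, Finset.insert_erase hx]⟩
    · refine ⟨[], List.nil_prefix, ?_⟩
      rw [List.toFinset_nil, eq_comm, Finset.eq_empty_iff_forall_notMem]
      intro v hv
      have h2 := hS hv
      simp only [List.toFinset_cons, Finset.mem_insert, List.mem_toFinset] at h2
      rcases h2 with rfl | h2
      · exact hx hv
      · exact hx (hdown x (by simp) v hv (hl.1 v h2))

/-- The initial segments of the order in which an orientation lists an ancestral clique are the
ancestral subsets of the clique. -/
theorem exists_prefix_iff_ancestral (hD : IsAMO G D) {K : Finset V} {π : List V}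
    (hπ : π ∈ permsOf K) (hK : Ancestral D (K : Set V)) (hpw : π.Pairwise D.Adj) {S : Finset V}
    (hS : S ⊆ K) : (∃ p, p <+: π ∧ p.toFinset = S) ↔ Ancestral D (S : Set V) := by
  obtain ⟨hnd, rfl⟩ := hπ
  constructor
  · rintro ⟨p, ⟨q, rfl⟩, rfl⟩ u v huv hv
    have hu := hK u v huv (hS hv)
    simp only [List.coe_toFinset, Set.mem_ofPred_eq, List.mem_append] at hu hv ⊢
    exact hu.resolve_right fun hq =>
      hD.oriented _ _ huv ((List.pairwise_append.1 hpw).2.2 v hv u hq)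
  · intro h
    exact exists_prefix_of_downward hpw hnd hS fun u _ v hv huv => h u v huv hv

end Lists

/-! ### Bags and paths in a clique tree -/

namespace RootedCliqueTree

variable {V W : Type*} {G : SimpleGraph V} (𝒯 : RootedCliqueTree G W)

theorem maximal (x : W) : Maximal (fun K : Finset V => G.IsClique (K : Set V)) (𝒯.ι x) := by
  have h : 𝒯.ι x ∈ maximalCliques G := 𝒯.bijOn.mapsTo (Set.mem_univ x)
  rwa [maximalCliques, Set.mem_ofPred_eq] at h

theorem isClique (x : W) : G.IsClique (𝒯.ι x : Set V) :=
  (𝒯.maximal x).prop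

theorem eq_of_subset {x y : W} (h : 𝒯.ι x ⊆ 𝒯.ι y) : x = y :=
  𝒯.bijOn.injOn (Set.mem_univ x) (Set.mem_univ y)
    ((𝒯.maximal x).eq_of_ge (𝒯.isClique y) h).symm

theorem exists_subset_of_isClique [Finite V] {Q : Finset V} (hQ : G.IsClique (Q : Set V)) :
    ∃ z, Q ⊆ 𝒯.ι z := by
  obtain ⟨K, hle, hK⟩ := Finite.exists_le_maximal
    (p := fun K : Finset V => G.IsClique (K : Set V)) hQ
  obtain ⟨z, -, rfl⟩ := 𝒯.bijOn.surjOn (show K ∈ maximalCliques G from hK)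
  exact ⟨z, hle⟩

theorem exists_mem_of_adj [Finite V] {u v : V} (h : G.Adj u v) :
    ∃ z, u ∈ 𝒯.ι z ∧ v ∈ 𝒯.ι z := by
  classical
  obtain ⟨z, hz⟩ := 𝒯.exists_subset_of_isClique (Q := {u, v}) (by
    simp [SimpleGraph.isClique_insert, h])
  exact ⟨z, hz (by simp), hz (by simp)⟩

theorem exists_walk_of_mem {u : V} {x y : W} (hx : u ∈ 𝒯.ι x) (hy : u ∈ 𝒯.ι y) :
    ∃ p : 𝒯.T.Walk x y, ∀ z ∈ p.support, u ∈ 𝒯.ι z := by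
  obtain ⟨q⟩ := (𝒯.connected u).preconnected ⟨x, hx⟩ ⟨y, hy⟩
  refine ⟨q.map (SimpleGraph.Embedding.induce {x | u ∈ 𝒯.ι x}).toHom, fun z hz => ?_⟩
  obtain ⟨a, -, rfl⟩ := List.mem_map.1 ((SimpleGraph.Walk.support_map _ q) ▸ hz)
  exact a.2

theorem path_eq {x y : W} {p q : 𝒯.T.Walk x y} (hp : p.IsPath) (hq : q.IsPath) : p = q :=
  (𝒯.isTree.existsUnique_path x y).unique hp hq

theorem mem_of_mem_support_path {u : V} {x y : W} (hx : u ∈ 𝒯.ι x) (hy : u ∈ 𝒯.ι y)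
    {p : 𝒯.T.Walk x y} (hp : p.IsPath) {z : W} (hz : z ∈ p.support) : u ∈ 𝒯.ι z := by
  classical
  obtain ⟨q, hq⟩ := 𝒯.exists_walk_of_mem hx hy
  rw [𝒯.path_eq hp q.bypass_isPath] at hz
  exact hq z (q.support_bypass_subset_support hz)

theorem exists_path (x y : W) : ∃ p : 𝒯.T.Walk x y, p.IsPath :=
  (𝒯.isTree.existsUnique_path x y).exists

end RootedCliqueTree

/-! ### Ancestral cliques and descendants -/

section Source

variable {V : Type*} {G : SimpleGraph V} {D : Digraph V}

/-- Within a set `X` of vertices, an ancestral clique of `X` that is maximal among these is maximal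
among all cliques of `X`. -/
theorem exists_relatively_ancestral_clique [Finite V] (hD : IsAMO G D) (X : Set V) :
    ∃ Q : Finset V, G.IsClique (Q : Set V) ∧ (Q : Set V) ⊆ X ∧
      (∀ u v, D.Adj u v → v ∈ Q → u ∈ X → u ∈ Q) ∧
      ∀ v ∈ X, (∀ q ∈ Q, v ≠ q → G.Adj v q) → v ∈ Q := by
  classical
  obtain ⟨Q, -, hQ⟩ := Finite.exists_le_maximal
    (p := fun Q : Finset V => G.IsClique (Q : Set V) ∧ (Q : Set V) ⊆ X ∧
      ∀ u v, D.Adj u v → v ∈ Q → u ∈ X → u ∈ Q) (a := ∅) (by simp)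
  obtain ⟨hcl, hsub, hanc⟩ := hQ.prop
  refine ⟨Q, hcl, hsub, hanc, fun v hv hadj => ?_⟩
  by_contra hvQ
  -- A candidate `m` without candidate ancestors can be added to `Q`: all of `Q` points to `m`, so
  -- by morality any parent of `m` in `X` outside `Q` would be a candidate too.
  have hwf : WellFounded (Relation.TransGen D.Adj) := by
    have : Std.Irrefl (Relation.TransGen D.Adj) := ⟨hD.acyclic⟩
    exact Finite.wellFounded_of_trans_of_irrefl _
  obtain ⟨m, ⟨hmX, hmQ, hmadj⟩, hmin⟩ := hwf.has_min
    {v | v ∈ X ∧ v ∉ Q ∧ ∀ q ∈ Q, v ≠ q → G.Adj v q} ⟨v, hv, hvQ, hadj⟩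
  refine hmQ (hQ.le_of_ge (y := insert m Q) ⟨?_, ?_, ?_⟩ (Finset.subset_insert _ _)
    (Finset.mem_insert_self _ _))
  · rw [Finset.coe_insert, SimpleGraph.isClique_insert]
    exact ⟨hcl, fun q hq hne => hmadj q hq hne⟩
  · rw [Finset.coe_insert, Set.insert_subset_iff]
    exact ⟨hmX, hsub⟩
  · intro u w huw hw huX
    rw [Finset.mem_insert] at hw ⊢
    rcases hw with rfl | hw
    · right
      by_contra huQ
      refine hmin u ⟨huX, huQ, fun q hq hne => ?_⟩ (Relation.TransGen.single huw)
      have hqw : D.Adj q w := by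
        refine ((hD.skeleton _ _).1 (hmadj q hq fun h => hmQ (h ▸ hq))).resolve_left fun h => ?_
        exact hmQ (hanc _ _ h hq hmX)
      exact hD.moral u w q hne huw hqw
    · exact Or.inr (hanc u w huw hw huX)

/-- Outside of a set `S`, the descendants of an ancestral set are closed under adjacency. -/
theorem exists_descent_of_adj (hD : IsAMO G D) {A S : Set V} (hA : Ancestral D A) {a d : V}
    (ha : a ∈ A) (haS : a ∉ S)
    (had : Relation.ReflTransGen (fun u v => D.Adj u v ∧ v ∉ S) a d) :
    ∀ n, n ∉ S → G.Adj n d →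
      ∃ a ∈ A, a ∉ S ∧ Relation.ReflTransGen (fun u v => D.Adj u v ∧ v ∉ S) a n := by
  induction had with
  | refl =>
    intro n hn hadj
    rcases (hD.skeleton _ _).1 hadj with h | h
    · exact ⟨n, hA _ _ h ha, hn, Relation.ReflTransGen.refl⟩
    · exact ⟨a, ha, haS, Relation.ReflTransGen.single ⟨h, hn⟩⟩
  | @tail d' d had' hd ih =>
    intro n hn hadj
    rcases (hD.skeleton _ _).1 hadj with h | h
    · by_cases hne : n = d'
      · exact ⟨a, ha, haS, hne ▸ had'⟩
      · exact ih n hn (hD.moral n d d' hne h hd.1)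
    · exact ⟨a, ha, haS, (had'.tail hd).tail ⟨h, hn⟩⟩

end Source

/-! ### The unique node belonging to an orientation -/

namespace RootedCliqueTree

variable {V W : Type*} [DecidableEq V] {G : SimpleGraph V} (𝒯 : RootedCliqueTree G W)
  {D : Digraph V}

theorem subset_of_mem_FP {x : W} {S : Finset V} (h : S ∈ 𝒯.FP x) : S ⊆ 𝒯.ι x := by
  obtain ⟨_, _, _, _, _, h⟩ := h
  exact h

/-- If every separator on the walk had an element outside `S = ι v ∩ ι w`, descent from `ι v`
avoiding `S` would spread from bag to bag and reach an element of `ι w`. As `ι w` is ancestral, the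
start of the descent would lie in both bags but not in `S`. -/
theorem exists_dart_inter_subset (hD : IsAMO G D) {v w : W} (hv : Ancestral D (𝒯.ι v : Set V))
    (hw : Ancestral D (𝒯.ι w : Set V)) (hne : v ≠ w) (p : 𝒯.T.Walk v w) :
    ∃ d ∈ p.darts, 𝒯.ι d.fst ∩ 𝒯.ι d.snd ⊆ 𝒯.ι v ∩ 𝒯.ι w := by
  by_contra! hcon
  set S : Finset V := 𝒯.ι v ∩ 𝒯.ι w with hS
  let desc : V → Prop := fun x => ∃ a ∈ (𝒯.ι v : Set V), a ∉ (S : Set V) ∧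
    Relation.ReflTransGen (fun u v => D.Adj u v ∧ v ∉ (S : Set V)) a x
  have hadj : ∀ d, desc d → ∀ n, n ∉ S → G.Adj n d → desc n := by
    rintro d ⟨a, ha, haS, had⟩ n hn h
    exact exists_descent_of_adj hD hv ha haS had n hn h
  have key : ∀ {x y : W} (q : 𝒯.T.Walk x y),
      (∀ d ∈ q.darts, ¬ 𝒯.ι d.fst ∩ 𝒯.ι d.snd ⊆ S) →
      (∀ k ∈ 𝒯.ι x, k ∉ S → desc k) → ∀ k ∈ 𝒯.ι y, k ∉ S → desc k := by
    intro x y q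
    induction q with
    | nil => exact fun _ h => h
    | @cons x z y hxz q ih =>
      intro hq hx
      simp only [SimpleGraph.Walk.darts_cons, List.mem_cons, forall_eq_or_imp] at hq
      refine ih hq.2 fun k hk hkS => ?_
      obtain ⟨m, hm, hmS⟩ := Finset.not_subset.1 hq.1
      rw [Finset.mem_inter] at hm
      have hm' := hx m hm.1 hmS
      by_cases hkm : k = m
      · exact hkm ▸ hm'
      · exact hadj m hm' k hkS (𝒯.isClique z hk hm.2 hkm)
  obtain ⟨k, hkw, hkv⟩ := Finset.not_subset.1 fun h => hne (𝒯.eq_of_subset h).symm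
  obtain ⟨a, hav, haS, hak⟩ := key p hcon
    (fun k hk hkS => ⟨k, hk, hkS, Relation.ReflTransGen.refl⟩) k hkw
    (fun h => hkv (Finset.mem_inter.1 h).1)
  have haw : a ∈ (𝒯.ι w : Set V) := by
    clear hkv
    have hkw' : k ∈ (𝒯.ι w : Set V) := hkw
    clear hkw
    induction hak with
    | refl => exact hkw'
    | tail _ h ih => exact ih (hw _ _ h.1 hkw')
  exact haS (Finset.mem_coe.2 (Finset.mem_inter.2 ⟨hav, haw⟩))

/-- Along a path every separator contains the intersection of the end bags, so the inclusion of
`exists_dart_inter_subset` is an equality. -/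
theorem exists_dart_inter_eq (hD : IsAMO G D) {v w : W} (hv : Ancestral D (𝒯.ι v : Set V))
    (hw : Ancestral D (𝒯.ι w : Set V)) (hne : v ≠ w) {p : 𝒯.T.Walk v w} (hp : p.IsPath) :
    ∃ d ∈ p.darts, 𝒯.ι d.fst ∩ 𝒯.ι d.snd = 𝒯.ι v ∩ 𝒯.ι w := by
  obtain ⟨d, hd, hsub⟩ := 𝒯.exists_dart_inter_subset hD hv hw hne p
  refine ⟨d, hd, hsub.antisymm fun k hk => ?_⟩
  rw [Finset.mem_inter] at hk ⊢
  exact ⟨𝒯.mem_of_mem_support_path hk.1 hk.2 hp (p.dart_fst_mem_support_of_mem_darts hd),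
    𝒯.mem_of_mem_support_path hk.1 hk.2 hp (p.dart_snd_mem_support_of_mem_darts hd)⟩

/-- The nodes that can be reached from the root without crossing an edge whose separator is
ancestral. -/
def rootComponent (D : Digraph V) : Set W :=
  {w | ∃ q : 𝒯.T.Walk 𝒯.r w, ∀ d ∈ q.darts, ¬ Ancestral D (𝒯.ι d.fst ∩ 𝒯.ι d.snd : Finset V)}

theorem mem_rootComponent_of_mem_support {w : W} {q : 𝒯.T.Walk 𝒯.r w}
    (hq : ∀ d ∈ q.darts, ¬ Ancestral D (𝒯.ι d.fst ∩ 𝒯.ι d.snd : Finset V)) {z : W}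
    (hz : z ∈ q.support) : z ∈ 𝒯.rootComponent D := by
  classical
  exact ⟨q.takeUntil z hz, fun d hd => hq d (q.darts_takeUntil_subset_darts hz hd)⟩

/-- Every bag meets the vertices of the root component inside a single bag of the root
component. -/
theorem exists_projection {z : W} (q : 𝒯.T.Walk z 𝒯.r) (hq : q.IsPath) :
    ∃ x ∈ 𝒯.rootComponent D, ∀ k ∈ 𝒯.ι z, (∃ c ∈ 𝒯.rootComponent D, k ∈ 𝒯.ι c) → k ∈ 𝒯.ι x := by
  classical
  suffices ∀ {z y : W} (q : 𝒯.T.Walk z y), y = 𝒯.r → q.IsPath → ∃ x ∈ 𝒯.rootComponent D,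
      ∀ k ∈ 𝒯.ι z, (∃ c ∈ 𝒯.rootComponent D, k ∈ 𝒯.ι c) → k ∈ 𝒯.ι x from this q rfl hq
  intro z y q
  induction q with
  | nil =>
    rintro rfl -
    exact ⟨_, ⟨SimpleGraph.Walk.nil, by simp⟩, fun k hk _ => hk⟩
  | @cons z z' y h q ih =>
    rintro rfl hq
    by_cases hz : z ∈ 𝒯.rootComponent D
    · exact ⟨z, hz, fun k hk _ => hk⟩
    rw [SimpleGraph.Walk.cons_isPath_iff] at hq
    obtain ⟨x, hx, hxk⟩ := ih rfl hq.1
    refine ⟨x, hx, fun k hk hc => hxk k ?_ hc⟩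
    obtain ⟨c, ⟨g, hg⟩, hkc⟩ := hc
    -- Going from `z'` to `c` through the root avoids `z`, so the tree path from `z` to `c` starts
    -- with the step to `z'`, and `k` lies in that bag.
    have hzs : z ∉ (q.append g).bypass.support := fun h => by
      have := (q.append g).support_bypass_subset_support h
      rw [SimpleGraph.Walk.mem_support_append_iff] at this
      exact this.elim hq.2 fun h' => hz (𝒯.mem_rootComponent_of_mem_support hg h')
    have hpath : (SimpleGraph.Walk.cons h (q.append g).bypass).IsPath :=
      (SimpleGraph.Walk.cons_isPath_iff _ _).2 ⟨(q.append g).bypass_isPath, hzs⟩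
    exact 𝒯.mem_of_mem_support_path hk hkc hpath (by simp)

/-- A maximal relatively ancestral clique in the vertices of the root component is a bag by
projection. It is ancestral in all of `G` because the component can only be left across an ancestral
separator, which holds back any parent from outside. -/
theorem exists_ancestral_node [Finite V] (hD : IsAMO G D) :
    ∃ w ∈ 𝒯.rootComponent D, Ancestral D (𝒯.ι w : Set V) := by
  obtain ⟨Q, hQ, hsub, hanc, hmax⟩ :=
    exists_relatively_ancestral_clique hD {k | ∃ c ∈ 𝒯.rootComponent D, k ∈ 𝒯.ι c}
  obtain ⟨z, hz⟩ := 𝒯.exists_subset_of_isClique hQ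
  obtain ⟨q, hq⟩ := 𝒯.exists_path z 𝒯.r
  obtain ⟨w, hw, hwk⟩ := 𝒯.exists_projection (D := D) q hq
  have hQw : Q = 𝒯.ι w := by
    have hle : Q ⊆ 𝒯.ι w := fun k hk => hwk k (hz hk) (hsub hk)
    exact hle.antisymm fun k hk =>
      hmax k ⟨w, hw, hk⟩ fun l hl hne => 𝒯.isClique w hk (hle hl) hne
  subst hQw
  refine ⟨w, hw, fun u v huv hv => hanc u v huv hv ?_⟩
  obtain ⟨y, huy, hvy⟩ := 𝒯.exists_mem_of_adj (hD.adj huv)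
  by_cases hy : y ∈ 𝒯.rootComponent D
  · exact ⟨y, hy, huy⟩
  obtain ⟨p, hp⟩ := 𝒯.exists_walk_of_mem hv hvy
  obtain ⟨d, hd, ⟨g, hg⟩, hd2⟩ := p.exists_boundary_dart _ hw hy
  have hvd : v ∈ ((𝒯.ι d.fst ∩ 𝒯.ι d.snd : Finset V) : Set V) :=
    Finset.mem_coe.2 (Finset.mem_inter.2 ⟨hp _ (p.dart_fst_mem_support_of_mem_darts hd),
      hp _ (p.dart_snd_mem_support_of_mem_darts hd)⟩)
  have hsep : Ancestral D (𝒯.ι d.fst ∩ 𝒯.ι d.snd : Finset V) := by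
    by_contra hcon
    refine hd2 ⟨g.concat d.adj, fun e he => ?_⟩
    rw [SimpleGraph.Walk.darts_concat, List.concat_eq_append, List.mem_append,
      List.mem_singleton] at he
    rcases he with he | rfl
    · exact hg e he
    · exact hcon
  exact ⟨d.fst, ⟨g, hg⟩, (Finset.mem_inter.1 (hsep u v huv hvd)).1⟩

/-- For every acyclic moral orientation exactly one node carries an ancestral bag without ancestral
forbidden prefix. -/
theorem existsUnique_node [Finite V] (hD : IsAMO G D) :
    ∃! w, Ancestral D (𝒯.ι w : Set V) ∧ ∀ S ∈ 𝒯.FP w, ¬ Ancestral D (S : Set V) := by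
  classical
  obtain ⟨w, ⟨g, hg⟩, hw⟩ := 𝒯.exists_ancestral_node hD
  have hg' : ∀ d ∈ g.bypass.darts, ¬ Ancestral D (𝒯.ι d.fst ∩ 𝒯.ι d.snd : Finset V) :=
    fun d hd => hg d (g.darts_bypass_subset_darts hd)
  refine ⟨w, ⟨hw, ?_⟩, ?_⟩
  · rintro S ⟨p, hp, d, hd, rfl, -⟩
    rw [𝒯.path_eq hp g.bypass_isPath] at hd
    exact hg' d hd
  · rintro v ⟨hv, hFP⟩
    by_contra hne
    obtain ⟨p, hp⟩ := 𝒯.exists_path 𝒯.r v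
    -- The separator equal to `ι v ∩ ι w` lies between the root and `v`, where it is a forbidden
    -- prefix of `v`, or between the root and `w`, where no separator is ancestral.
    obtain ⟨d, hd, heq⟩ := 𝒯.exists_dart_inter_eq hD hv hw hne
      (p.reverse.append g).bypass_isPath
    have hanc : Ancestral D (𝒯.ι d.fst ∩ 𝒯.ι d.snd : Finset V) := by
      rw [heq, Finset.coe_inter]
      exact hv.inter hw
    have hd' := (p.reverse.append g).darts_bypass_subset_darts hd
    rw [SimpleGraph.Walk.darts_append, List.mem_append, SimpleGraph.Walk.mem_darts_reverse] at hd'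
    rcases hd' with hd' | hd'
    · refine hFP _ ⟨p, hp, d.symm, hd', rfl, ?_⟩ ?_
      · rw [Finset.inter_comm]
        exact heq.subset.trans Finset.inter_subset_left
      · rw [Finset.inter_comm]
        exact hanc
    · exact hg d hd' hanc

end RootedCliqueTree

/-! ### Perfect numberings and acyclicity -/

/-- A numbering of the vertices such that the earlier neighbours of every vertex form a clique,
that is, the reverse of a perfect elimination ordering. -/
structure IsPerfectNumbering {V : Type*} (G : SimpleGraph V) (f : V → ℕ) : Prop where
  injective : Function.Injective f
  adj : ∀ a b c, a ≠ c → G.Adj a b → G.Adj c b → f a < f b → f c < f b → G.Adj a c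

/-- The orientation of a graph along a numbering of its vertices. -/
def numberingOrientation {V : Type*} (G : SimpleGraph V) (f : V → ℕ) : Digraph V where
  Adj u v := G.Adj u v ∧ f u < f v

theorem IsPerfectNumbering.isAMO {V : Type*} {G : SimpleGraph V} {f : V → ℕ}
    (hf : IsPerfectNumbering G f) : IsAMO G (numberingOrientation G f) where
  skeleton u v := by
    constructor
    · intro h
      rcases lt_or_gt_of_ne (hf.injective.ne h.ne) with hlt | hlt
      · exact Or.inl ⟨h, hlt⟩
      · exact Or.inr ⟨h.symm, hlt⟩
    · rintro (h | h)
      · exact h.1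
      · exact h.1.symm
  oriented u v h h' := lt_asymm h.2 h'.2
  acyclic v h := by
    have key : ∀ w, Relation.TransGen (numberingOrientation G f).Adj v w → f v < f w := by
      intro w hw
      induction hw with
      | single h => exact h.2
      | tail _ h ih => exact ih.trans h.2
    exact lt_irrefl _ (key v h)
  moral a b c hne hab hcb := hf.adj a b c hne hab.1 hcb.1 hab.2 hcb.2

/-- On a graph with a perfect numbering, an orientation without directed triangles is acyclic. -/
theorem IsPerfectNumbering.acyclic_of_no_triangle {V : Type*} [Finite V] {G : SimpleGraph V}
    {f : V → ℕ} (hf : IsPerfectNumbering G f) {D : Digraph V}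
    (hskel : ∀ u v, G.Adj u v ↔ D.Adj u v ∨ D.Adj v u) (hor : ∀ u v, D.Adj u v → ¬ D.Adj v u)
    (htri : ∀ a b c, D.Adj a b → D.Adj b c → ¬ D.Adj c a) (v : V) :
    ¬ Relation.TransGen D.Adj v v := by
  let R : ℕ → V → V → Prop := fun n u v => D.Adj u v ∧ f u < n ∧ f v < n
  -- A visit to the vertex numbered `n` can be bypassed: its predecessor and successor are earlier
  -- neighbours of it, hence adjacent, and without directed triangles that edge points forward.
  have shortcut : ∀ n a b, f a < n → Relation.TransGen (R (n + 1)) a b →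
      (f b < n → Relation.TransGen (R n) a b) ∧
      (f b = n → ∃ p, f p < n ∧ D.Adj p b ∧ Relation.ReflTransGen (R n) a p) := by
    intro n a b ha hab
    induction hab with
    | single h =>
      exact ⟨fun hb => .single ⟨h.1, ha, hb⟩, fun _ => ⟨a, ha, h.1, .refl⟩⟩
    | @tail b c _ h ih =>
      obtain ⟨hbc, hb, hc⟩ := h
      rcases (Nat.lt_succ_iff_lt_or_eq.1 hb) with hb | hb
      · exact ⟨fun hc => (ih.1 hb).tail ⟨hbc, hb, hc⟩,
          fun _ => ⟨b, hb, hbc, (ih.1 hb).to_reflTransGen⟩⟩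
      · obtain ⟨p, hp, hpb, hap⟩ := ih.2 hb
        constructor
        · intro hc
          have hpc : p ≠ c := by
            rintro rfl
            exact hor _ _ hpb hbc
          have hadj : G.Adj p c := hf.adj p b c hpc ((hskel _ _).2 (Or.inl hpb))
            ((hskel _ _).2 (Or.inr hbc)) (by omega) (by omega)
          have : D.Adj p c := ((hskel _ _).1 hadj).resolve_right (htri _ _ _ hpb hbc)
          exact Relation.TransGen.tail' hap ⟨this, hp, hc⟩
        · intro hc
          have : b = c := hf.injective (by omega)
          subst this
          exact (hor _ _ hbc hbc).elim
  have noCycle : ∀ n v, ¬ Relation.TransGen (R n) v v := by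
    intro n
    induction n with
    | zero =>
      intro v h
      obtain ⟨w, hw, -⟩ := Relation.TransGen.head'_iff.1 h
      exact absurd hw.2.1 (Nat.not_lt_zero _)
    | succ n ih =>
      have lower : ∀ v, f v < n → ¬ Relation.TransGen (R (n + 1)) v v :=
        fun v hv h => ih v ((shortcut n v v hv h).1 hv)
      intro v h
      obtain ⟨w, hw, hwv⟩ := Relation.TransGen.head'_iff.1 h
      rcases (Nat.lt_succ_iff_lt_or_eq.1 hw.2.1) with hv | hv
      · exact lower v hv h
      · rcases (Nat.lt_succ_iff_lt_or_eq.1 hw.2.2) with hw' | hw'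
        · exact lower w hw' (Relation.TransGen.tail' hwv hw)
        · have : v = w := hf.injective (by omega)
          subst this
          exact hor _ _ hw.1 hw.1
  obtain ⟨N, hN⟩ := (Set.finite_range f).bddAbove
  intro h
  refine noCycle (N + 1) v (Relation.TransGen.mono (fun a b hab => ⟨hab, ?_, ?_⟩) v v h) <;>
  exact Nat.lt_succ_of_le (hN (Set.mem_range_self _))

/-! ### Perfect numberings from a clique tree -/

namespace RootedCliqueTree

variable {V W : Type*} {G : SimpleGraph V} (𝒯 : RootedCliqueTree G W)

/-- The distance from the node `x` to the bags containing the vertex `u`. -/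
noncomputable def depth (x : W) (u : V) : ℕ :=
  sInf {n | ∃ t, u ∈ 𝒯.ι t ∧ 𝒯.T.dist x t = n}

theorem exists_dist_eq_depth (x : W) (u : V) : ∃ t, u ∈ 𝒯.ι t ∧ 𝒯.T.dist x t = 𝒯.depth x u := by
  obtain ⟨⟨t, ht⟩⟩ := (𝒯.connected u).nonempty
  exact Nat.sInf_mem (s := {n | ∃ t, u ∈ 𝒯.ι t ∧ 𝒯.T.dist x t = n}) ⟨_, t, ht, rfl⟩

theorem depth_le {x z : W} {u : V} (h : u ∈ 𝒯.ι z) : 𝒯.depth x u ≤ 𝒯.T.dist x z :=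
  Nat.sInf_le ⟨z, h, rfl⟩

theorem depth_eq_zero_iff {x : W} {u : V} : 𝒯.depth x u = 0 ↔ u ∈ 𝒯.ι x := by
  constructor
  · intro h
    obtain ⟨t, ht, hd⟩ := 𝒯.exists_dist_eq_depth x u
    rw [h, (𝒯.isTree.connected).dist_eq_zero_iff] at hd
    exact hd ▸ ht
  · intro h
    have := 𝒯.depth_le (x := x) h
    rwa [SimpleGraph.dist_self, Nat.le_zero] at this

/-- The path from `x` to a bag containing `u` consists of a path to the bag that is nearest to `x`,
followed by a path through bags containing `u`. -/
theorem exists_path_through_top {x t z : W} {u : V} (ht : u ∈ 𝒯.ι t)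
    (hd : 𝒯.T.dist x t = 𝒯.depth x u) (hz : u ∈ 𝒯.ι z) :
    ∃ (p : 𝒯.T.Walk x t) (q : 𝒯.T.Walk t z), (p.append q).IsPath ∧
      (∀ y ∈ p.support, y ≠ t → 𝒯.T.dist x y < 𝒯.T.dist x t) ∧ ∀ y ∈ q.support, u ∈ 𝒯.ι y := by
  classical
  obtain ⟨p, hp, hlen⟩ := (𝒯.isTree.connected).exists_path_of_dist x t
  obtain ⟨q, hq⟩ := 𝒯.exists_path t z
  have hlt : ∀ y ∈ p.support, y ≠ t → 𝒯.T.dist x y < 𝒯.T.dist x t := fun y hy hne =>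
    (SimpleGraph.dist_le (p.takeUntil y hy)).trans_lt
      (hlen ▸ SimpleGraph.Walk.length_takeUntil_lt_length hy hne)
  have hmem : ∀ y ∈ q.support, u ∈ 𝒯.ι y := fun y hy => 𝒯.mem_of_mem_support_path ht hz hq hy
  refine ⟨p, q, ?_, hlt, hmem⟩
  rw [SimpleGraph.Walk.isPath_def, SimpleGraph.Walk.support_append, List.nodup_append]
  refine ⟨hp.support_nodup, hq.support_nodup.tail, ?_⟩
  rintro y hy y' hy' rfl
  have hyt : y ≠ t := by
    rintro rfl
    have := hq.support_nodup
    rw [← SimpleGraph.Walk.cons_tail_support, List.nodup_cons] at this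
    exact this.1 hy'
  have h1 := hlt y hy hyt
  have h2 := 𝒯.depth_le (x := x) (hmem y (List.mem_of_mem_tail hy'))
  omega

/-- The path from `x` to `z` passes the nearest bags of both `a` and `b`. That of `a` cannot come
strictly later, and from it onwards all bags contain `a`. -/
theorem mem_top_of_depth_le {x t z : W} {a b : V} (ha : a ∈ 𝒯.ι z) (hb : b ∈ 𝒯.ι z)
    (hab : 𝒯.depth x a ≤ 𝒯.depth x b) (ht : b ∈ 𝒯.ι t) (hd : 𝒯.T.dist x t = 𝒯.depth x b) :
    a ∈ 𝒯.ι t := by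
  obtain ⟨s, hs, hds⟩ := 𝒯.exists_dist_eq_depth x a
  obtain ⟨p, q, hpq, hlt, hmem⟩ := 𝒯.exists_path_through_top hs hds ha
  obtain ⟨p', q', hpq', -, -⟩ := 𝒯.exists_path_through_top ht hd hb
  have ht' : t ∈ (p'.append q').support := by
    rw [SimpleGraph.Walk.mem_support_append_iff]
    exact Or.inl p'.end_mem_support
  rw [𝒯.path_eq hpq' hpq, SimpleGraph.Walk.mem_support_append_iff] at ht'
  rcases ht' with ht' | ht'
  · by_cases hts : t = s
    · exact hts ▸ hs
    · have := hlt t ht' hts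
      omega
  · exact hmem t ht'

/-- There is a perfect numbering that starts with any given bag, in any given order. -/
theorem exists_isPerfectNumbering [Finite V] (x : W) {e : V → ℕ} (he : Function.Injective e) :
    ∃ f, IsPerfectNumbering G f ∧ (∀ u ∈ 𝒯.ι x, ∀ v ∈ 𝒯.ι x, e u < e v → f u < f v) ∧
      ∀ u ∈ 𝒯.ι x, ∀ v ∉ 𝒯.ι x, f u < f v := by
  obtain ⟨N, hN⟩ := (Set.finite_range e).bddAbove
  have hN' : ∀ u, e u < N + 1 := fun u => Nat.lt_succ_of_le (hN (Set.mem_range_self u))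
  -- Lexicographic order by depth, then by `e`; as `e u ≤ N`, division by `N + 1` recovers the
  -- depth. All earlier neighbours of `b` lie in the bag containing `b` nearest to `x`.
  set f : V → ℕ := fun u => 𝒯.depth x u * (N + 1) + e u with hf
  have hdiv : ∀ u, f u / (N + 1) = 𝒯.depth x u := fun u => by
    simp only [hf]
    rw [mul_comm, Nat.mul_add_div (Nat.succ_pos N), Nat.div_eq_of_lt (hN' u), add_zero]
  have hle : ∀ u v, f u ≤ f v → 𝒯.depth x u ≤ 𝒯.depth x v := fun u v h => by
    rw [← hdiv u, ← hdiv v]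
    exact Nat.div_le_div_right h
  refine ⟨f, ⟨fun u v h => ?_, fun a b c hne hab hcb hfa hfc => ?_⟩, fun u hu v hv h => ?_,
    fun u hu v hv => ?_⟩
  · have hd : 𝒯.depth x u = 𝒯.depth x v := by rw [← hdiv u, ← hdiv v, h]
    refine he ?_
    simp only [hf, hd] at h
    omega
  · obtain ⟨t, ht, hd⟩ := 𝒯.exists_dist_eq_depth x b
    obtain ⟨z, haz, hbz⟩ := 𝒯.exists_mem_of_adj hab
    obtain ⟨z', hcz, hbz'⟩ := 𝒯.exists_mem_of_adj hcb
    exact 𝒯.isClique t (𝒯.mem_top_of_depth_le haz hbz (hle _ _ hfa.le) ht hd)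
      (𝒯.mem_top_of_depth_le hcz hbz' (hle _ _ hfc.le) ht hd) hne
  · simpa only [hf, 𝒯.depth_eq_zero_iff.2 hu, 𝒯.depth_eq_zero_iff.2 hv, zero_mul, zero_add] using h
  · by_contra hlt
    have := hle v u (not_lt.1 hlt)
    rw [𝒯.depth_eq_zero_iff.2 hu, Nat.le_zero] at this
    exact hv (𝒯.depth_eq_zero_iff.1 this)

/-- Every edge can be oriented either way. -/
theorem exists_isAMO_adj (𝒯 : RootedCliqueTree G W) [Fintype V] {u v : V}
    (h : G.Adj u v) : ∃ D, IsAMO G D ∧ D.Adj u v := by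
  obtain ⟨x, hu, hv⟩ := 𝒯.exists_mem_of_adj h
  obtain ⟨f, hf, hord, -⟩ := 𝒯.exists_isPerfectNumbering x
    (Fin.val_injective.comp (Fintype.equivFin V).injective)
  -- The reversed tie-break orients the edges inside the bag the other way.
  obtain ⟨g, hg, hord', -⟩ := 𝒯.exists_isPerfectNumbering x
    (e := fun w => Fintype.card V - Fintype.equivFin V w) (fun a b hab => by
      have ha := (Fintype.equivFin V a).2
      have hb := (Fintype.equivFin V b).2
      exact (Fintype.equivFin V).injective (Fin.ext (by dsimp only at hab; omega)))
  rcases lt_or_gt_of_ne ((Fin.val_injective.comp (Fintype.equivFin V).injective).ne h.ne)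
    with hlt | hlt
  · exact ⟨_, hf.isAMO, h, hord u hu v hv hlt⟩
  · refine ⟨_, hg.isAMO, h, hord' u hu v hv ?_⟩
    have := (Fintype.equivFin V u).2
    simp only [Function.comp_apply] at hlt
    omega

end RootedCliqueTree

/-! ### Forced and free edges -/

/-- The edges whose orientation is forced as soon as the set `K` is ancestral. -/
inductive Forced {V : Type*} (G : SimpleGraph V) (K : Finset V) : V → V → Prop
  | base {k v : V} : k ∈ K → v ∉ K → G.Adj k v → Forced G K k v
  | moral {a b c : V} : Forced G K a b → G.Adj b c → a ≠ c → ¬ G.Adj a c → Forced G K b c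
  | trans {a b c : V} : Forced G K a b → Forced G K b c → G.Adj a c → Forced G K a c

section

variable {V : Type*} {G : SimpleGraph V} {K : Finset V} {D : Digraph V}

theorem Forced.adj {a b : V} (h : Forced G K a b) : G.Adj a b := by
  cases h <;> assumption

theorem Forced.sound (hD : IsAMO G D) (hK : Ancestral D (K : Set V)) {a b : V}
    (h : Forced G K a b) : D.Adj a b := by
  induction h with
  | base hk hv hadj =>
    exact ((hD.skeleton _ _).1 hadj).resolve_right fun h => hv (hK _ _ h hk)
  | moral _ hadj hne hnadj ih =>
    exact ((hD.skeleton _ _).1 hadj).resolve_right fun h => hnadj (hD.moral _ _ _ hne ih h)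
  | trans _ _ hadj ih₁ ih₂ =>
    exact ((hD.skeleton _ _).1 hadj).resolve_right fun h =>
      hD.acyclic _ (((Relation.TransGen.single ih₁).tail ih₂).tail h)

theorem Forced.notMem (hD : IsAMO G D) (hK : Ancestral D (K : Set V)) {a b : V}
    (h : Forced G K a b) : b ∉ K := by
  induction h with
  | base _ hv _ => exact hv
  | moral h hadj hne hnadj ih =>
    exact fun hc => ih (hK _ _ ((h.moral hadj hne hnadj).sound hD hK) hc)
  | trans _ _ _ _ ih₂ => exact ih₂

/-- A forced edge into one end of a free edge is accompanied by a forced edge into the other end. -/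
theorem Forced.of_free {a b c : V} (h : Forced G K a b) (hc : c ∉ K) (hbc : G.Adj b c)
    (h₁ : ¬ Forced G K b c) (h₂ : ¬ Forced G K c b) : Forced G K a c := by
  induction h generalizing c with
  | @base a b ha hb hab =>
    have hac : G.Adj a c := by
      by_contra hac
      exact h₁ ((Forced.base ha hb hab).moral hbc (fun h => hc (h ▸ ha)) hac)
    exact .base ha hc hac
  | @moral d a b hda hab hne hdb ih =>
    have hFab : Forced G K a b := hda.moral hab hne hdb
    have hac' : a ≠ c := by
      rintro rfl
      exact h₂ hFab
    have hac : G.Adj a c := by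
      by_contra hac
      exact h₁ (hFab.moral hbc hac' hac)
    -- Otherwise `a c` is free as well, so the induction hypothesis moves the forced edge `d → a` to
    -- `d → c`, and the moral rule then forces `c → b`.
    by_contra hFac
    have hFca : ¬ Forced G K c a := fun h => h₂ (h.trans hFab hbc.symm)
    have hdc := ih hc hac hFac hFca
    exact h₂ (hdc.moral hbc.symm hne hdb)
  | @trans a d b had hdb hab ih₁ ih₂ =>
    have hdc := ih₂ hc hbc h₁ h₂
    have hFab : Forced G K a b := had.trans hdb hab
    have hac' : a ≠ c := by
      rintro rfl
      exact h₂ hFab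
    have hac : G.Adj a c := by
      by_contra hac
      exact h₁ (hFab.moral hbc hac' hac)
    exact had.trans hdc hac

/-- The graph of the edges outside of `K` that are not forced. -/
def freeGraph (G : SimpleGraph V) (K : Finset V) : SimpleGraph {v : V // v ∉ K} where
  Adj u v := G.Adj u v ∧ ¬ Forced G K u v ∧ ¬ Forced G K v u
  symm := ⟨fun _ _ h => ⟨h.1.symm, h.2.2, h.2.1⟩⟩
  loopless := ⟨fun _ h => h.1.ne rfl⟩

/-- The free edges of an orientation. -/
def freePart (G : SimpleGraph V) (K : Finset V) (D : Digraph V) : Digraph {v : V // v ∉ K} where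
  Adj u v := (freeGraph G K).Adj u v ∧ D.Adj u v

/-- Only morality needs care: two free parents of `b` are adjacent in `G`, and if that edge were
forced, `Forced.of_free` would force one of the free edges into `b`. -/
theorem IsAMO.freePart (hD : IsAMO G D) (K : Finset V) :
    IsAMO (freeGraph G K) (freePart G K D) where
  skeleton u v := by
    constructor
    · intro h
      exact ((hD.skeleton _ _).1 h.1).imp (fun h' => ⟨h, h'⟩) fun h' => ⟨h.symm, h'⟩
    · rintro (h | h)
      · exact h.1
      · exact h.1.symm
  oriented u v h h' := hD.oriented _ _ h.2 h'.2
  acyclic v h := hD.acyclic v (Relation.TransGen.lift Subtype.val (fun _ _ h => h.2) _ _ h)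
  moral a b c hne hab hcb := by
    refine ⟨hD.moral a b c (fun h => hne (Subtype.ext h)) hab.2 hcb.2, fun h => ?_, fun h => ?_⟩
    · exact hab.1.2.1 (h.of_free b.2 hcb.1.1 hcb.1.2.1 hcb.1.2.2)
    · exact hcb.1.2.1 (h.of_free b.2 hab.1.1 hab.1.2.1 hab.1.2.2)

end

/-! ### Gluing orientations -/

section

variable {V : Type*} [DecidableEq V] {G : SimpleGraph V} {K : Finset V} {D : Digraph V}

/-- The orientation that follows `π` inside of `K`, agrees with `δ` on the free edges, and contains
all forced edges. -/
def glue (G : SimpleGraph V) (K : Finset V) (π : List V) (δ : Digraph {v : V // v ∉ K}) :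
    Digraph V where
  Adj u v := (u ∈ K ∧ v ∈ K ∧ π.idxOf u < π.idxOf v) ∨ Forced G K u v ∨
    ∃ (hu : u ∉ K) (hv : v ∉ K), δ.Adj ⟨u, hu⟩ ⟨v, hv⟩

/-- The orientation `D` only certifies that the forced edges are consistent. The perfect numbering
reduces acyclicity to triangles; triangles and colliders that mix forced and free edges are handled
by `Forced.of_free`. -/
theorem isAMO_glue [Finite V] (hD : IsAMO G D) (hKD : Ancestral D (K : Set V)) {f : V → ℕ}
    (hf : IsPerfectNumbering G f) (hK : G.IsClique (K : Set V)) {π : List V} (hπ : π ∈ permsOf K)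
    {δ : Digraph {v : V // v ∉ K}} (hδ : IsAMO (freeGraph G K) δ) :
    IsAMO G (glue G K π δ) := by
  have hmemπ : ∀ u, u ∈ K ↔ u ∈ π := fun u => by rw [← hπ.2, List.mem_toFinset]
  have hskel : ∀ u v, G.Adj u v ↔ (glue G K π δ).Adj u v ∨ (glue G K π δ).Adj v u := by
    intro u v
    constructor
    · intro h
      by_cases hu : u ∈ K <;> by_cases hv : v ∈ K
      · have : π.idxOf u ≠ π.idxOf v := fun h' => h.ne ((List.idxOf_inj ((hmemπ u).1 hu)).1 h')
        exact (lt_or_gt_of_ne this).imp (fun h' => Or.inl ⟨hu, hv, h'⟩)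
          fun h' => Or.inl ⟨hv, hu, h'⟩
      · exact Or.inl (Or.inr (Or.inl (.base hu hv h)))
      · exact Or.inr (Or.inr (Or.inl (.base hv hu h.symm)))
      · by_cases h₁ : Forced G K u v
        · exact Or.inl (Or.inr (Or.inl h₁))
        by_cases h₂ : Forced G K v u
        · exact Or.inr (Or.inr (Or.inl h₂))
        have : (freeGraph G K).Adj ⟨u, hu⟩ ⟨v, hv⟩ := ⟨h, h₁, h₂⟩
        exact ((hδ.skeleton _ _).1 this).imp (fun h' => Or.inr (Or.inr ⟨hu, hv, h'⟩))
          fun h' => Or.inr (Or.inr ⟨hv, hu, h'⟩)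
    · have key : ∀ u v, (glue G K π δ).Adj u v → G.Adj u v := by
        rintro u v (⟨hu, hv, h⟩ | h | ⟨hu, hv, h⟩)
        · exact hK hu hv (by rintro rfl; exact lt_irrefl _ h)
        · exact h.adj
        · exact (hδ.adj h).1
      exact fun h => h.elim (key u v) fun h => (key v u h).symm
  have hor : ∀ u v, (glue G K π δ).Adj u v → ¬ (glue G K π δ).Adj v u := by
    rintro u v (⟨hu, hv, h⟩ | h | ⟨hu, hv, h⟩) (⟨hu', hv', h'⟩ | h' | ⟨hu', hv', h'⟩)
    · exact lt_asymm h h'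
    · exact h'.notMem hD hKD hu
    · exact hu' hv
    · exact h.notMem hD hKD hu'
    · exact hD.oriented _ _ (h.sound hD hKD) (h'.sound hD hKD)
    · exact (hδ.adj h').2.2 h
    · exact hv hu'
    · exact (hδ.adj h).2.2 h'
    · exact hδ.oriented _ _ h h'
  have hinto : ∀ u v, (glue G K π δ).Adj u v → v ∈ K → u ∈ K ∧ π.idxOf u < π.idxOf v := by
    rintro u v (⟨hu, hv, h⟩ | h | ⟨hu, hv, h⟩) hvK
    · exact ⟨hu, h⟩
    · exact (h.notMem hD hKD hvK).elim
    · exact (hv hvK).elim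
  have hout : ∀ u v, (glue G K π δ).Adj u v → v ∉ K → Forced G K u v ∨
      ∃ (hu : u ∉ K) (hv : v ∉ K), δ.Adj ⟨u, hu⟩ ⟨v, hv⟩ := by
    rintro u v (⟨hu, hv, h⟩ | h) hvK
    · exact (hvK hv).elim
    · exact h
  refine ⟨hskel, hor, hf.acyclic_of_no_triangle hskel hor ?_, ?_⟩
  · have hmix : ∀ a b c (ha : a ∉ K) (hb : b ∉ K), δ.Adj ⟨a, ha⟩ ⟨b, hb⟩ → (glue G K π δ).Adj b c →
        ¬ Forced G K c a := by
      intro a b c ha hb hab hbc hca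
      have := hδ.adj hab
      exact hor _ _ hbc (Or.inr (Or.inl (hca.of_free hb this.1 this.2.1 this.2.2)))
    intro a b c hab hbc hca
    by_cases haK : a ∈ K
    · obtain ⟨hcK, hlt⟩ := hinto _ _ hca haK
      obtain ⟨hbK, hlt'⟩ := hinto _ _ hbc hcK
      obtain ⟨-, hlt''⟩ := hinto _ _ hab hbK
      omega
    have hbK : b ∉ K := fun hb => haK (hinto _ _ hab hb).1
    have hcK : c ∉ K := fun hc => hbK (hinto _ _ hbc hc).1
    rcases hout _ _ hab hbK with hab' | ⟨_, _, hab'⟩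
    · rcases hout _ _ hbc hcK with hbc' | ⟨_, _, hbc'⟩
      · rcases hout _ _ hca haK with hca' | ⟨_, _, hca'⟩
        · exact hD.acyclic a (((Relation.TransGen.single (hab'.sound hD hKD)).tail
            (hbc'.sound hD hKD)).tail (hca'.sound hD hKD))
        · exact hmix _ _ _ _ _ hca' hab hbc'
      · exact hmix _ _ _ _ _ hbc' hca hab'
    · rcases hout _ _ hca haK with hca' | ⟨_, _, hca'⟩
      · exact hmix _ _ _ _ _ hab' hbc hca'
      · rcases hout _ _ hbc hcK with hbc' | ⟨_, _, hbc'⟩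
        · exact hmix _ _ _ _ _ hca' hab hbc'
        · exact hδ.acyclic _ (((Relation.TransGen.single hab').tail hbc').tail hca')
  · intro a b c hne hab hcb
    by_cases hbK : b ∈ K
    · exact hK (hinto _ _ hab hbK).1 (hinto _ _ hcb hbK).1 hne
    rcases hout _ _ hab hbK with hab' | ⟨_, _, hab'⟩ <;>
      rcases hout _ _ hcb hbK with hcb' | ⟨hc, _, hcb'⟩
    · exact hD.moral a b c hne (hab'.sound hD hKD) (hcb'.sound hD hKD)
    · have := hδ.adj hcb'
      exact (hab'.of_free hc this.1.symm this.2.2 this.2.1).adj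
    · have := hδ.adj hab'
      exact (hcb'.of_free (by assumption) this.1.symm this.2.2 this.2.1).adj.symm
    · exact (hδ.moral _ _ _ (fun h => hne (congrArg Subtype.val h)) hab' hcb').1

theorem ancestral_glue (hD : IsAMO G D) (hKD : Ancestral D (K : Set V)) {π : List V}
    {δ : Digraph {v : V // v ∉ K}} : Ancestral (glue G K π δ) (K : Set V) := by
  rintro u v (⟨hu, hv, h⟩ | h | ⟨hu, hv, h⟩) hvK
  · exact hu
  · exact (h.notMem hD hKD hvK).elim
  · exact (hv hvK).elim

theorem pairwise_glue {π : List V} (hπ : π ∈ permsOf K) {δ : Digraph {v : V // v ∉ K}} :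
    π.Pairwise (glue G K π δ).Adj := by
  rw [List.pairwise_iff_getElem]
  intro i j hi hj hij
  refine Or.inl ⟨?_, ?_, by rwa [hπ.1.idxOf_getElem, hπ.1.idxOf_getElem]⟩ <;>
  · rw [← hπ.2, List.mem_toFinset]; exact List.getElem_mem _

theorem freePart_glue {π : List V} {δ : Digraph {v : V // v ∉ K}}
    (hδ : IsAMO (freeGraph G K) δ) : freePart G K (glue G K π δ) = δ := by
  ext u v
  constructor
  · rintro ⟨hfree, ⟨hu, -⟩ | h | ⟨_, _, h⟩⟩
    · exact (u.2 hu).elim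
    · exact (hfree.2.1 h).elim
    · exact h
  · intro h
    exact ⟨hδ.adj h, Or.inr (Or.inr ⟨u.2, v.2, h⟩)⟩

/-- Both sides orient each edge of `G` exactly once, so it suffices that every edge of `D` occurs in
the glued orientation. -/
theorem glue_freePart [Finite V] (hD : IsAMO G D) (hKD : Ancestral D (K : Set V)) {f : V → ℕ}
    (hf : IsPerfectNumbering G f) (hK : G.IsClique (K : Set V)) {π : List V} (hπ : π ∈ permsOf K)
    (hpw : π.Pairwise D.Adj) : glue G K π (freePart G K D) = D := by
  have hmemπ : ∀ u, u ∈ K ↔ u ∈ π := fun u => by rw [← hπ.2, List.mem_toFinset]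
  have hglue := isAMO_glue hD hKD hf hK hπ (hD.freePart K)
  have hle : ∀ u v, D.Adj u v → (glue G K π (freePart G K D)).Adj u v := by
    intro u v huv
    by_cases hv : v ∈ K
    · have hu : u ∈ K := hKD u v huv hv
      exact Or.inl ⟨hu, hv, idxOf_lt_idxOf_of_pairwise (hpw.imp fun h => hD.oriented _ _ h)
        ((hmemπ u).1 hu) ((hmemπ v).1 hv) huv (hD.adj huv).ne⟩
    by_cases hu : u ∈ K
    · exact Or.inr (Or.inl (.base hu hv (hD.adj huv)))
    by_cases h₁ : Forced G K u v
    · exact Or.inr (Or.inl h₁)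
    · exact Or.inr (Or.inr ⟨hu, hv, ⟨hD.adj huv, h₁,
        fun h₂ => hD.oriented _ _ huv (h₂.sound hD hKD)⟩, huv⟩)
  ext u v
  refine ⟨fun h => ((hD.skeleton u v).1 (hglue.adj h)).resolve_right fun h' => ?_, hle u v⟩
  exact hglue.oriented _ _ h (hle v u h')

end

theorem numAMO_eq_natCard {V : Type*} (G : SimpleGraph V) :
    numAMO G = Nat.card {D : Digraph V // IsAMO G D} :=
  rfl

/-! ### Factorization over connected components -/

section Components

variable {V : Type*} {U : SimpleGraph V}

/-- The orientation assembled from orientations of the connected components. -/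
def componentUnion (d : ∀ H : U.ConnectedComponent, Digraph H) : Digraph V where
  Adj u v := ∃ (H : U.ConnectedComponent) (hu : u ∈ H) (hv : v ∈ H), (d H).Adj ⟨u, hu⟩ ⟨v, hv⟩

theorem component_eq {u : V} {H H' : U.ConnectedComponent} (h : u ∈ H) (h' : u ∈ H') : H = H' := by
  rw [← SetLike.mem_coe] at h h'
  exact h.symm.trans h'

theorem componentUnion_adj_iff {d : ∀ H : U.ConnectedComponent, Digraph H}
    {H : U.ConnectedComponent} (a b : H) : (componentUnion d).Adj a b ↔ (d H).Adj a b := by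
  constructor
  · rintro ⟨H', hu, hv, h⟩
    obtain rfl := component_eq hu a.2
    exact h
  · exact fun h => ⟨H, a.2, b.2, h⟩

theorem isAMO_componentUnion {d : ∀ H : U.ConnectedComponent, Digraph H}
    (hd : ∀ H, IsAMO H.toSimpleGraph (d H)) : IsAMO U (componentUnion d) where
  skeleton u v := by
    constructor
    · intro h
      have hu : u ∈ U.connectedComponentMk u := rfl
      have hv : v ∈ U.connectedComponentMk u :=
        (SimpleGraph.ConnectedComponent.connectedComponentMk_eq_of_adj h).symm
      have h' : (U.connectedComponentMk u).toSimpleGraph.Adj ⟨u, hu⟩ ⟨v, hv⟩ := h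
      exact (((hd _).skeleton _ _).1 h').imp (fun h => ⟨_, hu, hv, h⟩) fun h => ⟨_, hv, hu, h⟩
    · rintro (⟨H, hu, hv, h⟩ | ⟨H, hv, hu, h⟩)
      · exact (hd H).adj h
      · exact SimpleGraph.Adj.symm (G := U) ((hd H).adj h)
  oriented := by
    rintro u v ⟨H, hu, hv, h⟩ h'
    exact (hd H).oriented _ _ h ((componentUnion_adj_iff (d := d) ⟨v, hv⟩ ⟨u, hu⟩).1 h')
  acyclic v h := by
    have key : ∀ w, Relation.TransGen (componentUnion d).Adj v w →
        ∃ (H : U.ConnectedComponent) (hv : v ∈ H) (hw : w ∈ H),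
          Relation.TransGen (d H).Adj ⟨v, hv⟩ ⟨w, hw⟩ := by
      intro w hw
      induction hw with
      | single h =>
        obtain ⟨H, hu, hv, h⟩ := h
        exact ⟨H, hu, hv, .single h⟩
      | tail _ h ih =>
        obtain ⟨H, hu, hv, h⟩ := h
        obtain ⟨H', hu', hv', h'⟩ := ih
        obtain rfl := component_eq hu hv'
        exact ⟨H, hu', hv, h'.tail h⟩
    obtain ⟨H, _, _, h⟩ := key v h
    exact (hd H).acyclic _ h
  moral := by
    rintro a b c hne ⟨H, ha, hb, hab⟩ ⟨H', hc, hb', hcb⟩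
    obtain rfl := component_eq hb hb'
    exact (hd H).moral _ _ _ (fun h => hne (congrArg Subtype.val h)) hab hcb

theorem IsAMO.component {D : Digraph V} (hD : IsAMO U D) (H : U.ConnectedComponent) :
    IsAMO H.toSimpleGraph ⟨fun a b : H => D.Adj a b⟩ where
  skeleton u v := hD.skeleton u v
  oriented u v := hD.oriented u v
  acyclic v h := hD.acyclic v (Relation.TransGen.lift Subtype.val (fun _ _ h => h) _ _ h)
  moral a b c hne := hD.moral a b c fun h => hne (Subtype.ext h)

/-- The acyclic moral orientations of a graph are the combinations of those of its connected
components. -/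
theorem numAMO_eq_prod (U : SimpleGraph V) [Fintype U.ConnectedComponent] :
    numAMO U = ∏ H : U.ConnectedComponent, numAMO H.toSimpleGraph := by
  simp only [numAMO_eq_natCard]
  rw [← Nat.card_pi]
  refine Nat.card_congr
    { toFun := fun D H => ⟨_, D.2.component H⟩
      invFun := fun d => ⟨componentUnion fun H => (d H).1, isAMO_componentUnion fun H => (d H).2⟩
      left_inv := ?_
      right_inv := ?_ }
  · rintro ⟨D, hD⟩
    ext u v
    constructor
    · rintro ⟨H, hu, hv, h⟩
      exact h
    · intro h
      exact ⟨U.connectedComponentMk u, rfl,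
        (SimpleGraph.ConnectedComponent.connectedComponentMk_eq_of_adj (hD.adj h)).symm, h⟩
  · intro d
    ext H a b
    exact componentUnion_adj_iff a b

end Components

/-! ### Counting -/

section

variable {V W : Type*} [Fintype V] [DecidableEq V] {G : SimpleGraph V}

theorem cliqueOrientation_adj_iff {K : Finset V} (hK : G.IsClique (K : Set V)) (u v : V) :
    (cliqueOrientation G K).Adj u v ↔
      ∃ D, IsAMO G D ∧ Ancestral D (K : Set V) ∧ D.Adj u v := by
  simp only [cliqueOrientation, permOrientation, Digraph.iSup_adj, Digraph.sSup_adj]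
  constructor
  · rintro ⟨π, hπ, D, ⟨hD, hτ⟩, huv⟩
    exact ⟨D, hD, ((isTopologicalOrdering_prefix_iff hD hK hπ).1 hτ).1, huv⟩
  · rintro ⟨D, hD, hKD, huv⟩
    obtain ⟨π, hπ, hpw⟩ := exists_perm_of_isClique hD hK
    exact ⟨π, hπ, D, ⟨hD, (isTopologicalOrdering_prefix_iff hD hK hπ).2 ⟨hKD, hpw⟩⟩, huv⟩

theorem finite_permsOf (S : Finset V) : (permsOf S).Finite := by
  refine (List.finite_length_le V (Fintype.card V)).subset fun l hl => ?_
  exact hl.1.length_le_card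

namespace RootedCliqueTree

variable (𝒯 : RootedCliqueTree G W)

theorem exists_isAMO_ancestral (x : W) :
    ∃ D, IsAMO G D ∧ Ancestral D (𝒯.ι x : Set V) := by
  obtain ⟨f, hf, -, hfirst⟩ := 𝒯.exists_isPerfectNumbering x
    (Fin.val_injective.comp (Fintype.equivFin V).injective)
  refine ⟨_, hf.isAMO, fun u v huv hv => ?_⟩
  by_contra hu
  exact lt_asymm huv.2 (hfirst v hv u hu)

/-- The undirected edges outside of a bag are exactly those that are not forced. -/
theorem undirectedPart_eq_freeGraph (x : W) :
    undirectedPart G (𝒯.ι x) = freeGraph G (𝒯.ι x) := by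
  obtain ⟨D₀, hD₀, hK⟩ := 𝒯.exists_isAMO_ancestral x
  obtain ⟨π, hπ, -⟩ := exists_perm_of_isClique hD₀ (𝒯.isClique x)
  obtain ⟨f, hf, -⟩ := 𝒯.exists_isPerfectNumbering x
    (Fin.val_injective.comp (Fintype.equivFin V).injective)
  have key : ∀ u v, (freeGraph G (𝒯.ι x)).Adj u v →
      (cliqueOrientation G (𝒯.ι x)).Adj u v := by
    intro u v h
    -- `D` need not make the bag ancestral: its free part is transplanted onto the forced edges.
    obtain ⟨D, hD, huv⟩ := 𝒯.exists_isAMO_adj h.1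
    rw [cliqueOrientation_adj_iff (𝒯.isClique x)]
    exact ⟨_, isAMO_glue hD₀ hK hf (𝒯.isClique x) hπ (hD.freePart _), ancestral_glue hD₀ hK,
      Or.inr (Or.inr ⟨u.2, v.2, h, huv⟩)⟩
  ext u v
  constructor
  · rintro ⟨-, huv, hvu⟩
    rw [cliqueOrientation_adj_iff (𝒯.isClique x)] at huv hvu
    obtain ⟨D, hD, hKD, huv⟩ := huv
    obtain ⟨D', hD', hKD', hvu⟩ := hvu
    exact ⟨hD.adj huv, fun h => hD'.oriented _ _ hvu (h.sound hD' hKD'),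
      fun h => hD.oriented _ _ huv (h.sound hD hKD)⟩
  · intro h
    exact ⟨fun h' => h.ne (Subtype.ext h'), key u v h, key v u h.symm⟩

/-- The acyclic moral orientations correspond to the choices of a node, of an admissible
permutation of its bag, and of an orientation of the free edges. -/
theorem numAMO_eq_sum [Fintype W] :
    numAMO G = ∑ x : W, phi (𝒯.ι x) (𝒯.FP x) * numAMO (freeGraph G (𝒯.ι x)) := by
  let P : W → Set (List V) := fun x =>
    {π ∈ permsOf (𝒯.ι x) | ∀ p : List V, p <+: π → p.toFinset ∉ 𝒯.FP x}
  have hfin : ∀ x, Finite (P x) := fun x =>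
    ((finite_permsOf (𝒯.ι x)).subset fun _ h => h.1).to_subtype
  obtain ⟨f, hf, -⟩ := 𝒯.exists_isPerfectNumbering 𝒯.r
    (Fin.val_injective.comp (Fintype.equivFin V).injective)
  have hAMO : ∀ x, ∀ π ∈ permsOf (𝒯.ι x), ∀ δ, IsAMO (freeGraph G (𝒯.ι x)) δ →
      IsAMO G (glue G (𝒯.ι x) π δ) ∧ Ancestral (glue G (𝒯.ι x) π δ) (𝒯.ι x : Set V) := by
    intro x π hπ δ hδ
    obtain ⟨D, hD, hK⟩ := 𝒯.exists_isAMO_ancestral x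
    exact ⟨isAMO_glue hD hK hf (𝒯.isClique x) hπ hδ, ancestral_glue hD hK⟩
  let g : (Σ x, P x × {δ // IsAMO (freeGraph G (𝒯.ι x)) δ}) → {D // IsAMO G D} := fun c =>
    ⟨glue G (𝒯.ι c.1) c.2.1 c.2.2, (hAMO c.1 _ c.2.1.2.1 _ c.2.2.2).1⟩
  -- The glued orientation gives back the node by `existsUnique_node`, then the permutation as its
  -- order on the bag, then `δ` as its free part.
  have hbij : Function.Bijective g := by
    constructor
    · rintro ⟨x, ⟨π, hπ, hπF⟩, δ, hδ⟩ ⟨y, ⟨ρ, hρ, hρF⟩, ε, hε⟩ h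
      have h : glue G (𝒯.ι x) π δ = glue G (𝒯.ι y) ρ ε := congrArg Subtype.val h
      obtain ⟨hD, hx⟩ := hAMO x π hπ δ hδ
      obtain ⟨hE, hy⟩ := hAMO y ρ hρ ε hε
      have hFx : ∀ S ∈ 𝒯.FP x, ¬ Ancestral (glue G (𝒯.ι x) π δ) (S : Set V) := fun S hS hanc => by
        obtain ⟨p, hp, rfl⟩ := (exists_prefix_iff_ancestral hD hπ hx (pairwise_glue hπ)
          (𝒯.subset_of_mem_FP hS)).2 hanc
        exact hπF p hp hS
      have hFy : ∀ S ∈ 𝒯.FP y, ¬ Ancestral (glue G (𝒯.ι y) ρ ε) (S : Set V) := fun S hS hanc => by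
        obtain ⟨p, hp, rfl⟩ := (exists_prefix_iff_ancestral hE hρ hy (pairwise_glue hρ)
          (𝒯.subset_of_mem_FP hS)).2 hanc
        exact hρF p hp hS
      rw [← h] at hy hFy
      obtain rfl : x = y := (𝒯.existsUnique_node hD).unique ⟨hx, hFx⟩ ⟨hy, hFy⟩
      have hpw := pairwise_glue (G := G) hρ (δ := ε)
      rw [← h] at hpw
      obtain rfl : π = ρ := perm_unique hD hπ hρ (pairwise_glue hπ) hpw
      obtain rfl : δ = ε := by
        rw [← freePart_glue (π := π) hδ, h, freePart_glue hε]
      rfl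
    · rintro ⟨D, hD⟩
      obtain ⟨x, ⟨hx, hF⟩, -⟩ := 𝒯.existsUnique_node hD
      obtain ⟨π, hπ, hpw⟩ := exists_perm_of_isClique hD (𝒯.isClique x)
      refine ⟨⟨x, ⟨π, hπ, fun p hp hS => ?_⟩, _, hD.freePart _⟩, Subtype.ext ?_⟩
      · exact hF _ hS ((exists_prefix_iff_ancestral hD hπ hx hpw (𝒯.subset_of_mem_FP hS)).1
          ⟨p, hp, rfl⟩)
      · exact glue_freePart hD hx hf (𝒯.isClique x) hπ hpw
  rw [numAMO_eq_natCard, ← Nat.card_congr (Equiv.ofBijective g hbij), Nat.card_sigma]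
  exact Finset.sum_congr rfl fun x _ => Nat.card_prod _ _

end RootedCliqueTree

end

end CliquePicking

/- The hypothesis `hG` is not needed: a graph with a clique tree is chordal, and connectedness plays
no role in the argument. -/
theorem mainTheorem3 {V W : Type*} [Fintype V] [DecidableEq V] [Fintype W]
    (G : SimpleGraph V) (hG : CliquePicking.IsUCCG G)
    (𝒯 : CliquePicking.RootedCliqueTree G W) :
    CliquePicking.numAMO G =
      ∑ v : W, CliquePicking.phi (𝒯.ι v) (𝒯.FP v) *
        ∏ H : CliquePicking.Components G (𝒯.ι v),
          CliquePicking.numAMO H.toSimpleGraph := by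
  rw [𝒯.numAMO_eq_sum]
  refine Finset.sum_congr rfl fun x _ => ?_
  rw [← CliquePicking.numAMO_eq_prod, 𝒯.undirectedPart_eq_freeGraph]
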